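/- An $m$-choice game is a two-player win-lose coordination game (WLC-game) $G=(A,C_1,C_2,W_G)$: finite non-empty disjoint choice sets $C_1,C_2$ with $A=C_1\cup C_2$ and $\max\{|C_1|,|C_2|\}=m$, and a winning relation $W_G\subseteq C_1\times C_2$ such that every choice occurs in some winning pair. $\mathrm{CM}_m$ denotes the choice matching game, in which $|C_1|=|C_2|=m$ and $W_G$ is a perfect matching. The game is played in rounds; in each round both players simultaneously pick a choice, and play goes on until the picked pair is winning. A stage is the game together with its history, the sequence of pairs picked so far. A protocol assigns to every stage of every two-player WLC-game and every player a probability distribution on the player's choices (the two players draw independently), and it is required to be structural, i.e. invariant under all bijective renamings of choices, possibly interchanging the two players, that preserve the winning relation and the history. The expected coordination time (ECT) of a protocol in $G$ is the expected number (possibly $\infty$) of rounds until coordination when both players follow it from the empty history; the optimal ECT of a game is the minimum of the ECTs over all protocols. The wait-or-move protocol WM picks the first choice uniformly at random. In a later non-final stage (one in which no pair picked so far is winning) it proceeds as follows. If each player has so far picked only one single choice (possibly several times), then with probability $\frac12$ a player repeats his choice, and with probability $\frac12$ he picks uniformly one of the choices that coordinate with the choice of the other player. If each player has so far picked exactly two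 different choices, he picks each of his two choices with probability $\frac12$. In every other stage he picks uniformly at random. Theorem. Let $m\notin\{1,3,5\}$ and let $G$ be an $m$-choice game that is not isomorphic to $\mathrm{CM}_m$ (up to renaming of choices and players). Then the optimal ECT in $\mathrm{CM}_m$ exists, and the ECT in $G$ with WM is strictly smaller than the optimal ECT in $\mathrm{CM}_m$. -/

import Mathlib

open scoped ENNReal

noncomputable section

/-- An `n`-player win-lose coordination game. The choice sets are given as a family of types, so
they are pairwise disjoint, and the domain of choices is their disjoint union. `Win` is the
winning relation, and every choice belongs to some winning choice profile. -/
structure WLCGame (n : ℕ) where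
  Choice : Fin n → Type
  [fintypeChoice : ∀ i, Fintype (Choice i)]
  [nonemptyChoice : ∀ i, Nonempty (Choice i)]
  Win : Set (∀ i, Choice i)
  no_surely_losing : ∀ i (c : Choice i), ∃ σ ∈ Win, σ i = c

attribute [instance] WLCGame.fintypeChoice WLCGame.nonemptyChoice

namespace WLCGame

variable {n : ℕ}

/-- Choice profiles of `G`. -/
abbrev Profile (G : WLCGame n) : Type := ∀ i, G.Choice i

/-- Histories: finite sequences of choice profiles, the most recent one first. A stage of a
repeated play is a pair `(G, H)` with `H : G.History`; the initial stage is `(G, [])`. -/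
abbrev History (G : WLCGame n) : Type := List G.Profile

/-- A stage is non-final if no round played so far was won. -/
def NonFinal (G : WLCGame n) (H : G.History) : Prop := ∀ σ ∈ H, σ ∉ G.Win

/-- A renaming `(perm, map)` between the stages `(G, H)` and `(G', H')`: a permutation of the
players and a bijection between the domains. As the bijection has to send `C (perm i)` onto
`C' i`, it is given by its restrictions to these sets. It respects the winning relation and, round
by round, the history. -/
structure Renaming (G : WLCGame n) (H : G.History) (G' : WLCGame n) (H' : G'.History) where
  perm : Equiv.Perm (Fin n)
  map : ∀ i, G.Choice (perm i) ≃ G'.Choice i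
  win_iff : ∀ σ : G.Profile, σ ∈ G.Win ↔ (fun i => map i (σ (perm i))) ∈ G'.Win
  history_eq : H' = H.map (fun σ i => map i (σ (perm i)))

/-- Two games are the same up to the names of choices and players. -/
def Isomorphic (G G' : WLCGame n) : Prop := Nonempty (Renaming G [] G' [])

/-- The choice matching game with `n` players and `m` choices for each player: the winning choice
profiles are the `m` profiles in which all the players choose the same `k`. -/
def choiceMatching (n m : ℕ) [NeZero m] : WLCGame n where
  Choice := fun _ => Fin m
  Win := {σ | ∃ k : Fin m, ∀ i, σ i = k}
  no_surely_losing := fun _ c => ⟨fun _ => c, ⟨c, fun _ => rfl⟩, rfl⟩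

/-- `G` is an `m`-choice game: a two-player game whose larger choice set has `m` elements. -/
def IsChoiceGame (G : WLCGame 2) (m : ℕ) : Prop :=
  m = max (Fintype.card (G.Choice 0)) (Fintype.card (G.Choice 1))

end WLCGame

open WLCGame

/-- A structural protocol for `n`-player games: it assigns to every stage of every game and to
every player a probability distribution on the choices of this player, and it is indifferent with
respect to renamings. -/
structure Protocol (n : ℕ) where
  dist : ∀ (G : WLCGame n) (_ : G.History) (i : Fin n), PMF (G.Choice i)
  structural : ∀ (G : WLCGame n) (H : G.History) (G' : WLCGame n) (H' : G'.History)
    (ρ : Renaming G H G' H') (i : Fin n) (c : G.Choice (ρ.perm i)),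
    dist G H (ρ.perm i) c = dist G' H' i (ρ.map i c)

namespace Protocol

variable {n : ℕ}

/-- The probability that the next round played from `(G, H)` is the choice profile `σ` when the
players follow `π`, each drawing independently. -/
def roundProb (π : Protocol n) (G : WLCGame n) (H : G.History) (σ : G.Profile) : ℝ≥0∞ :=
  ∏ i, π.dist G H i (σ i)

open Classical in
/-- The probability that, when all the players follow `π` from the stage `(G, H)`, the next `k`
rounds fail and the round after them is the first one that is won; so that exactly `k + 1` rounds
are needed for coordination. -/
def coordProb (π : Protocol n) (G : WLCGame n) : ℕ → G.History → ℝ≥0∞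
  | 0, H => ∑ σ : G.Profile, if σ ∈ G.Win then π.roundProb G H σ else 0
  | k + 1, H => ∑ σ : G.Profile,
      if σ ∈ G.Win then 0 else π.roundProb G H σ * coordProb π G k (σ :: H)

/-- The expected coordination time from the (non-final) stage `(G, H)`: the expected value of the
number of rounds until coordination, which is `k + 1` with probability `coordProb k` and infinite
with the remaining probability (where `⊤ * 0 = 0`). -/
def ectFrom (π : Protocol n) (G : WLCGame n) (H : G.History) : ℝ≥0∞ :=
  (∑' k : ℕ, ((k : ℝ≥0∞) + 1) * π.coordProb G k H) + ⊤ * (1 - ∑' k : ℕ, π.coordProb G k H)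

/-- The expected coordination time in `G`, from the initial stage. -/
def ect (π : Protocol n) (G : WLCGame n) : ℝ≥0∞ := π.ectFrom G []

end Protocol

/-- `r` is the optimal expected coordination time of `G`: the minimum over all protocols. -/
def IsOptimalECT {n : ℕ} (G : WLCGame n) (r : ℝ≥0∞) : Prop :=
  IsLeast (Set.range fun π : Protocol n => π.ect G) r

open Classical in
/-- The uniform distribution on `s` (on the whole type if `s` is empty). -/
def uniformOn {α : Type} [Fintype α] [Nonempty α] (s : Finset α) : PMF α :=
  if h : s.Nonempty then PMF.uniformOfFinset s h else PMF.uniformOfFintype α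

namespace WLCGame

variable {n : ℕ}

open Classical in
/-- The choices that player `i` has selected in the previous rounds. -/
def past (G : WLCGame n) (H : G.History) (i : Fin n) : Finset (G.Choice i) :=
  Finset.univ.filter fun c => ∃ σ ∈ H, σ i = c

open Classical in
/-- The choices of player `i` in a two-player game that coordinate with a choice that the other
player has selected in the previous rounds. -/
def coordinating (G : WLCGame 2) (H : G.History) (i : Fin 2) : Finset (G.Choice i) :=
  Finset.univ.filter fun c => ∃ σ ∈ G.Win, σ i = c ∧ ∀ j, j ≠ i → σ j ∈ G.past H j

theorem mem_past (G : WLCGame n) (H : G.History) (i : Fin n) (c : G.Choice i) :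
    c ∈ G.past H i ↔ ∃ σ ∈ H, σ i = c := by
  simp [past]

theorem mem_coordinating (G : WLCGame 2) (H : G.History) (i : Fin 2) (c : G.Choice i) :
    c ∈ G.coordinating H i ↔ ∃ σ ∈ G.Win, σ i = c ∧ ∀ j, j ≠ i → σ j ∈ G.past H j := by
  simp [coordinating]

theorem coordinating_nonempty (G : WLCGame 2) (H : G.History) (i : Fin 2)
    (hH : ∀ j, (G.past H j).Nonempty) : (G.coordinating H i).Nonempty := by
  obtain ⟨j, hj⟩ : ∃ j : Fin 2, ∀ k, k ≠ i → k = j := by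
    refine ⟨1 - i, ?_⟩
    revert i; decide
  obtain ⟨d, hd⟩ := hH j
  obtain ⟨σ, hσ, rfl⟩ := G.no_surely_losing j d
  exact ⟨σ i, (mem_coordinating ..).2 ⟨σ, hσ, rfl, fun k hk => by rwa [hj k hk]⟩⟩

end WLCGame

open Classical in
/-- The distributions of the wait-or-move protocol. If both players have selected a single choice,
then with probability `1/2` keep it, and with probability `1/2` select, uniformly, a choice that
coordinates with the earlier choice of the other player. If both have selected exactly two choices,
then select one of your own previous two choices, each with probability `1/2`. In every other
stage, in particular in the initial one, select uniformly at random. -/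
def wmDist (G : WLCGame 2) (H : G.History) (i : Fin 2) : PMF (G.Choice i) :=
  if G.NonFinal H ∧ ∀ j, (G.past H j).card = 1 then
    (PMF.uniformOfFintype Bool).bind fun stay =>
      if stay then uniformOn (G.past H i) else uniformOn (G.coordinating H i)
  else if G.NonFinal H ∧ ∀ j, (G.past H j).card = 2 then
    uniformOn (G.past H i)
  else
    PMF.uniformOfFintype (G.Choice i)

theorem uniformOn_equiv {α β : Type} [Fintype α] [Nonempty α] [Fintype β] [Nonempty β]
    (e : α ≃ β) (s : Finset α) (t : Finset β) (h : ∀ a, a ∈ s ↔ e a ∈ t) (a : α) :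
    uniformOn s a = uniformOn t (e a) := by
  have hst : s.map e.toEmbedding = t := by
    ext b
    obtain ⟨a, rfl⟩ := e.surjective b
    simp [h]
  subst hst
  unfold uniformOn
  by_cases hs : s.Nonempty
  · simp only [hs, dif_pos, Finset.map_nonempty, PMF.uniformOfFinset_apply, Finset.card_map]
    by_cases ha : a ∈ s
    · rw [if_pos ha, if_pos ((h a).1 ha)]
    · rw [if_neg ha, if_neg fun hb => ha ((h a).2 hb)]
  · simp [hs, PMF.uniformOfFintype_apply, Fintype.card_congr e]

theorem WLCGame.Renaming.mem_past {n : ℕ} {G G' : WLCGame n} {H : G.History} {H' : G'.History}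
    (ρ : Renaming G H G' H') (i : Fin n) (c : G.Choice (ρ.perm i)) :
    c ∈ G.past H (ρ.perm i) ↔ ρ.map i c ∈ G'.past H' i := by
  have h : ∀ τ, τ ∈ H' ↔ ∃ σ ∈ H, (fun i => ρ.map i (σ (ρ.perm i))) = τ := fun τ => by
    have := congrArg (τ ∈ ·) ρ.history_eq
    simpa using this
  simp only [WLCGame.mem_past, h]
  simp

theorem WLCGame.Renaming.card_past {n : ℕ} {G G' : WLCGame n} {H : G.History} {H' : G'.History}
    (ρ : Renaming G H G' H') (i : Fin n) :
    (G.past H (ρ.perm i)).card = (G'.past H' i).card :=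
  Finset.card_equiv (ρ.map i) fun c => ρ.mem_past i c

theorem WLCGame.Renaming.forall_card_past {n : ℕ} {G G' : WLCGame n} {H : G.History}
    {H' : G'.History} (ρ : Renaming G H G' H') (k : ℕ) :
    (∀ j, (G.past H j).card = k) ↔ ∀ j, (G'.past H' j).card = k := by
  refine ⟨fun h j => (ρ.card_past j).symm.trans (h _), fun h j => ?_⟩
  obtain ⟨j, rfl⟩ := ρ.perm.surjective j
  exact (ρ.card_past j).trans (h j)

theorem WLCGame.Renaming.nonFinal_iff {n : ℕ} {G G' : WLCGame n} {H : G.History}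
    {H' : G'.History} (ρ : Renaming G H G' H') : G.NonFinal H ↔ G'.NonFinal H' := by
  unfold WLCGame.NonFinal
  rw [ρ.history_eq]
  simp [← ρ.win_iff]

theorem WLCGame.Renaming.exists_profile {n : ℕ} {G G' : WLCGame n} {H : G.History}
    {H' : G'.History} (ρ : Renaming G H G' H') (τ : G'.Profile) :
    ∃ σ : G.Profile, (fun i => ρ.map i (σ (ρ.perm i))) = τ := by
  have h := (Equiv.piCongrLeft G.Choice ρ.perm).symm.surjective
    (fun i => (ρ.map i).symm (τ i))
  obtain ⟨σ, hσ⟩ := h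
  refine ⟨σ, ?_⟩
  funext i
  have := congrFun hσ i
  simp only [Equiv.piCongrLeft_symm_apply] at this
  rw [this, Equiv.apply_symm_apply]

theorem WLCGame.Renaming.mem_coordinating {G G' : WLCGame 2} {H : G.History} {H' : G'.History}
    (ρ : Renaming G H G' H') (i : Fin 2) (c : G.Choice (ρ.perm i)) :
    c ∈ G.coordinating H (ρ.perm i) ↔ ρ.map i c ∈ G'.coordinating H' i := by
  rw [WLCGame.mem_coordinating, WLCGame.mem_coordinating]
  constructor
  · rintro ⟨σ, hσ, rfl, h⟩
    exact ⟨_, (ρ.win_iff σ).1 hσ, rfl, fun j hj =>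
      (ρ.mem_past j _).1 (h _ fun e => hj (ρ.perm.injective e))⟩
  · rintro ⟨τ, hτ, hc, h⟩
    obtain ⟨σ, rfl⟩ := ρ.exists_profile τ
    refine ⟨σ, (ρ.win_iff σ).2 hτ, (ρ.map i).injective hc, fun j hj => ?_⟩
    obtain ⟨j, rfl⟩ := ρ.perm.surjective j
    exact (ρ.mem_past j _).2 (h j fun e => hj (by rw [e]))

/-- The wait-or-move protocol. -/
def waitOrMove : Protocol 2 where
  dist := wmDist
  structural := by
    intro G H G' H' ρ i c
    unfold wmDist
    have h1 := and_congr ρ.nonFinal_iff (ρ.forall_card_past 1)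
    have h2 := and_congr ρ.nonFinal_iff (ρ.forall_card_past 2)
    have hp := uniformOn_equiv (ρ.map i) _ _ (ρ.mem_past i) c
    have hq := uniformOn_equiv (ρ.map i) _ _ (ρ.mem_coordinating i) c
    by_cases c1 : G.NonFinal H ∧ ∀ j, (G.past H j).card = 1
    · rw [if_pos c1, if_pos (h1.1 c1)]
      simp only [PMF.bind_apply, tsum_bool, Bool.false_eq_true, if_false, if_true, hp, hq]
    rw [if_neg c1, if_neg fun h => c1 (h1.2 h)]
    by_cases c2 : G.NonFinal H ∧ ∀ j, (G.past H j).card = 2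
    · rw [if_pos c2, if_pos (h2.1 c2)]
      exact hp
    rw [if_neg c2, if_neg fun h => c2 (h2.2 h)]
    simp [PMF.uniformOfFintype_apply, Fintype.card_congr (ρ.map i)]

end

/-!
The expected coordination time `T` of a protocol satisfies `T(H) = 1 + E[T(σ :: H); σ fails]`, and
it is the least solution, so every supersolution bounds it from above and every bounded
subsolution bounds it from below.

After a failed first round `σ`, a wait-or-move player repeats his choice with probability `1/2` and
otherwise moves to a choice that coordinates with the choice of the other player in `σ`. A round in
which exactly one player moves wins, and if both move without winning, then the same dichotomy
holds with fixed targets for the moves. Hence every later round wins with probability at least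
`1/2`, and the expected coordination time is at most `1 + 2 (1 - p)`, where `p` is the probability
of winning the first round.

In a choice matching game, as long as no round has been won, the structure of the game and the
history has an involution `τ` of the edges that interchanges the players. A structural protocol
therefore gives an edge `a` the same probability `p_a` for player 1 as `τ a` for player 2, so by
the rearrangement inequality the next round is won with probability at most `∑ p_a ^ 2`. The losing
outcomes `(a, τ a)` with `a` touched have the probabilities `p_a ^ 2`, and since the untouched
edges are equally likely, the losing outcomes `(a, b)` with `a ≠ b` untouched make up for the
remaining terms, provided that the number of untouched edges is not `1`. The number of untouched
edges drops by `0` or `2` per round, so this gives the bound `2` for the expected remaining time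
after the first round, except when `1` or `3` edges are then untouched, that is, for `m = 3` and
`m = 5`. (For `5` untouched edges the four choices of `b` compensate for the smaller bound at `3`.)

The first round is won with probability `1 / m` in the choice matching game under every protocol,
and with a larger probability in every other `m`-choice game under wait-or-move.
-/

open WLCGame

theorem sum_pmf_eq_one {α : Type*} [Fintype α] (p : PMF α) : ∑ a, p a = 1 := by
  rw [← tsum_fintype (L := .unconditional _), PMF.tsum_coe]

theorem tsum_tsum_nat_add (f : ℕ → ℝ≥0∞) :
    ∑' k, ∑' j, f (j + k) = ∑' l : ℕ, ((l : ℝ≥0∞) + 1) * f l := by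
  calc ∑' k, ∑' j, f (j + k)
      = ∑' p : ℕ × ℕ, f (p.2 + p.1) := ENNReal.tsum_prod.symm
    _ = ∑' x : Σ l : ℕ, Finset.HasAntidiagonal.antidiagonal l, f x.1 := by
      rw [← Finset.HasAntidiagonal.sigmaAntidiagonalEquivProd.tsum_eq]
      refine tsum_congr fun x => congrArg f ?_
      rw [add_comm]
      exact Finset.HasAntidiagonal.mem_antidiagonal.1 x.2.2
    _ = ∑' l : ℕ, ((l : ℝ≥0∞) + 1) * f l := by
      rw [ENNReal.tsum_sigma']
      simp

namespace Protocol

variable {n : ℕ} (π : Protocol n) (G : WLCGame n)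

open Classical in
/-- The expected value of `f` at the profile of the next round, restricted to the event that this
round fails. -/
noncomputable def failExp (H : G.History) (f : G.Profile → ℝ≥0∞) : ℝ≥0∞ :=
  ∑ σ with σ ∉ G.Win, π.roundProb G H σ * f σ

/-- The probability that the next `k` rounds played from `(G, H)` fail. -/
noncomputable def failProb : ℕ → G.History → ℝ≥0∞
  | 0, _ => 1
  | k + 1, H => π.failExp G H fun σ => failProb k (σ :: H)

theorem sum_roundProb (H : G.History) : ∑ σ, π.roundProb G H σ = 1 := by
  classical
  simp only [roundProb, ← Fintype.piFinset_univ, ← Finset.prod_univ_sum, sum_pmf_eq_one,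
    Finset.prod_const_one]

theorem coordProb_succ (k : ℕ) (H : G.History) :
    π.coordProb G (k + 1) H = π.failExp G H fun σ => π.coordProb G k (σ :: H) := by
  simp only [coordProb, failExp, Finset.sum_filter, ite_not]

section FailExp

variable {π G} {H : G.History} {f g : G.Profile → ℝ≥0∞}

theorem failExp_mono (h : ∀ σ ∉ G.Win, π.roundProb G H σ ≠ 0 → f σ ≤ g σ) :
    π.failExp G H f ≤ π.failExp G H g := by
  refine Finset.sum_le_sum fun σ hσ => ?_
  rcases eq_or_ne (π.roundProb G H σ) 0 with h₀ | h₀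
  · simp only [h₀, zero_mul, le_refl]
  · gcongr
    exact h σ (by simpa using hσ) h₀

theorem failExp_add :
    π.failExp G H (fun σ => f σ + g σ) = π.failExp G H f + π.failExp G H g := by
  simp only [failExp, mul_add, Finset.sum_add_distrib]

theorem failExp_const_mul (c : ℝ≥0∞) :
    π.failExp G H (fun σ => c * f σ) = c * π.failExp G H f := by
  simp only [failExp, mul_left_comm _ c, Finset.mul_sum]

theorem failExp_sum {ι : Type*} (s : Finset ι) (f : ι → G.Profile → ℝ≥0∞) :
    π.failExp G H (fun σ => ∑ j ∈ s, f j σ) = ∑ j ∈ s, π.failExp G H (f j) := by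
  simp only [failExp, Finset.mul_sum]
  exact Finset.sum_comm

theorem failExp_tsum (f : ℕ → G.Profile → ℝ≥0∞) :
    π.failExp G H (fun σ => ∑' j, f j σ) = ∑' j, π.failExp G H (f j) := by
  simp only [failExp, ← ENNReal.tsum_mul_left]
  exact (Summable.tsum_finsetSum fun _ _ => ENNReal.summable).symm

end FailExp

theorem coordProb_zero_add_failExp_one (H : G.History) :
    π.coordProb G 0 H + π.failExp G H (fun _ => 1) = 1 := by
  classical
  simp only [coordProb, failExp, mul_one, ← Finset.sum_filter]
  exact (Finset.sum_filter_add_sum_filter_not ..).trans (π.sum_roundProb G H)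

theorem coordProb_zero_le_one (H : G.History) : π.coordProb G 0 H ≤ 1 :=
  le_self_add.trans_eq (π.coordProb_zero_add_failExp_one G H)

theorem failExp_one (H : G.History) :
    π.failExp G H (fun _ => 1) = 1 - π.coordProb G 0 H :=
  ENNReal.eq_sub_of_add_eq'
    ENNReal.one_ne_top ((add_comm ..).trans (π.coordProb_zero_add_failExp_one G H))

theorem failExp_const (H : G.History) (c : ℝ≥0∞) :
    π.failExp G H (fun _ => c) = c * (1 - π.coordProb G 0 H) := by
  rw [← failExp_one, ← failExp_const_mul, mul_one]

theorem coordProb_add_failProb (k : ℕ) (H : G.History) :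
    π.coordProb G k H + π.failProb G (k + 1) H = π.failProb G k H := by
  induction k generalizing H with
  | zero => exact π.coordProb_zero_add_failExp_one G H
  | succ k ih =>
    rw [coordProb_succ, failProb, ← failExp_add, failProb]
    simp only [ih]

theorem sum_coordProb_add_failProb (k : ℕ) (H : G.History) :
    ∑ j ∈ Finset.range k, π.coordProb G j H + π.failProb G k H = 1 := by
  induction k with
  | zero => simp only [Finset.range_zero, Finset.sum_empty, failProb, zero_add]
  | succ k ih => rw [Finset.sum_range_succ, add_assoc, coordProb_add_failProb, ih]

theorem tsum_coordProb_le_one (H : G.History) : ∑' k, π.coordProb G k H ≤ 1 :=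
  ENNReal.tsum_le_of_sum_range_le fun k =>
    le_self_add.trans_eq (π.sum_coordProb_add_failProb G k H)

theorem failProb_eq_tsum_coordProb (k : ℕ) (H : G.History) :
    π.failProb G k H = ∑' j, π.coordProb G (j + k) H + (1 - ∑' j, π.coordProb G j H) := by
  have hsplit := ENNReal.summable.sum_add_tsum_nat_add' (f := fun j => π.coordProb G j H) (k := k)
  have hfin : ∑ j ∈ Finset.range k, π.coordProb G j H ≠ ⊤ :=
    ne_top_of_le_ne_top ENNReal.one_ne_top
      (le_self_add.trans_eq (π.sum_coordProb_add_failProb G k H))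
  rw [← ENNReal.add_right_inj hfin, sum_coordProb_add_failProb, ← add_assoc, hsplit,
    add_tsub_cancel_of_le (π.tsum_coordProb_le_one G H)]

theorem ectFrom_eq_tsum_failProb (H : G.History) :
    π.ectFrom G H = ∑' k, π.failProb G k H := by
  simp only [failProb_eq_tsum_coordProb, ENNReal.tsum_add, ENNReal.tsum_const,
    ENat.card_eq_top_of_infinite, tsum_tsum_nat_add fun j => π.coordProb G j H,
    ENat.toENNReal_top, ectFrom]

theorem ectFrom_eq_one_add_failExp (H : G.History) :
    π.ectFrom G H = 1 + π.failExp G H fun σ => π.ectFrom G (σ :: H) := by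
  simp only [ectFrom_eq_tsum_failProb, failExp_tsum]
  rw [tsum_eq_zero_add' ENNReal.summable]
  simp only [failProb]

theorem sum_failProb_succ (k : ℕ) (H : G.History) :
    ∑ j ∈ Finset.range (k + 1), π.failProb G j H =
      1 + π.failExp G H fun σ => ∑ j ∈ Finset.range k, π.failProb G j (σ :: H) := by
  rw [Finset.sum_range_succ', add_comm, failExp_sum]
  simp only [failProb]

theorem ectFrom_le_of_one_add_failExp_le (f : G.History → ℝ≥0∞)
    (hf : ∀ H, 1 + π.failExp G H (fun σ => f (σ :: H)) ≤ f H) (H : G.History) :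
    π.ectFrom G H ≤ f H := by
  have hsum : ∀ k H, ∑ j ∈ Finset.range k, π.failProb G j H ≤ f H := fun k => by
    induction k with
    | zero => simp
    | succ k ih =>
      intro H
      rw [sum_failProb_succ]
      exact (add_le_add_right (failExp_mono fun σ _ _ => ih _) 1).trans (hf H)
  rw [ectFrom_eq_tsum_failProb]
  exact ENNReal.tsum_le_of_sum_range_le fun k => hsum k H

theorem le_ectFrom_of_le_one_add_failExp (f : G.History → ℝ≥0∞) {B : ℝ≥0∞} (hB : B ≠ ⊤)
    (hfB : ∀ H, f H ≤ B) (hf : ∀ H, f H ≤ 1 + π.failExp G H fun σ => f (σ :: H))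
    (H : G.History) : f H ≤ π.ectFrom G H := by
  have hsum : ∀ k H,
      f H ≤ ∑ j ∈ Finset.range k, π.failProb G j H + B * π.failProb G k H := fun k => by
    induction k with
    | zero => simpa [failProb] using hfB
    | succ k ih =>
      intro H
      rw [sum_failProb_succ, failProb, ← failExp_const_mul, add_assoc, ← failExp_add]
      exact (hf H).trans (add_le_add_right (failExp_mono fun σ _ _ => ih _) 1)
  rw [ectFrom_eq_tsum_failProb]
  by_cases hfin : ∑' k, π.failProb G k H = ⊤
  · exact hfin ▸ le_top
  have hlim := ENNReal.Tendsto.const_mul (a := B)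
    (ENNReal.tendsto_atTop_zero_of_tsum_ne_top hfin) (.inr hB)
  have hlim' := hlim.const_add (∑' k, π.failProb G k H)
  rw [mul_zero, add_zero] at hlim'
  exact ge_of_tendsto' hlim' fun k =>
    (hsum k H).trans (add_le_add_left (ENNReal.sum_le_tsum (Finset.range k)) _)

theorem ectFrom_le_inv_of_le_coordProb {p : ℝ≥0∞} (I : G.History → Prop)
    (hI : ∀ H, I H → ∀ σ ∉ G.Win, π.roundProb G H σ ≠ 0 → I (σ :: H))
    (hp : ∀ H, I H → p ≤ π.coordProb G 0 H) {H : G.History} (hH : I H) :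
    π.ectFrom G H ≤ p⁻¹ := by
  classical
  rcases eq_or_ne p 0 with rfl | hp₀
  · simp
  have hstep : ∀ H, I H → 1 + p⁻¹ * π.failExp G H (fun _ => 1) ≤ p⁻¹ := fun H hH => by
    have hp₁ : p ≠ ⊤ := ne_top_of_le_ne_top ENNReal.one_ne_top
      ((hp H hH).trans (π.coordProb_zero_le_one G H))
    calc 1 + p⁻¹ * π.failExp G H (fun _ => 1)
        = p⁻¹ * (p + π.failExp G H fun _ => 1) := by
          rw [mul_add, ENNReal.inv_mul_cancel hp₀ hp₁]
      _ ≤ p⁻¹ * (π.coordProb G 0 H + π.failExp G H fun _ => 1) := by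
          gcongr
          exact hp H hH
      _ = p⁻¹ := by rw [coordProb_zero_add_failExp_one, mul_one]
  have hle := π.ectFrom_le_of_one_add_failExp_le G (fun H => if I H then p⁻¹ else ⊤)
    (fun H => ?_) H
  · simpa only [if_pos hH] using hle
  by_cases hH : I H
  · rw [if_pos hH]
    refine le_trans ?_ (hstep H hH)
    rw [← failExp_const_mul, mul_one]
    gcongr
    exact failExp_mono fun σ hσ hσ₀ => (if_pos (hI H hH σ hσ hσ₀)).le
  · rw [if_neg hH]
    exact le_top

end Protocol

/-- The mixture of two distributions, each with weight `1/2`. -/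
noncomputable def fairMix {α : Type*} (p q : PMF α) : PMF α :=
  (PMF.uniformOfFintype Bool).bind fun b => if b then p else q

theorem fairMix_apply {α : Type*} (p q : PMF α) (x : α) :
    fairMix p q x = 2⁻¹ * p x + 2⁻¹ * q x := by
  simp [fairMix, PMF.bind_apply, PMF.uniformOfFintype_apply]

theorem mem_support_fairMix {α : Type*} {p q : PMF α} {x : α} :
    x ∈ (fairMix p q).support ↔ x ∈ p.support ∨ x ∈ q.support := by
  simp [fairMix, or_comm]

section UniformOn

variable {α : Type} [Fintype α] [Nonempty α]

theorem uniformOn_eq_uniformOfFinset {s : Finset α} (hs : s.Nonempty) :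
    uniformOn s = PMF.uniformOfFinset s hs :=
  dif_pos hs

theorem uniformOn_singleton (a : α) : uniformOn {a} = PMF.pure a := by
  classical
  ext x
  simp [uniformOn_eq_uniformOfFinset, PMF.uniformOfFinset_apply, PMF.pure_apply]

theorem uniformOn_pair [DecidableEq α] {a b : α} (h : a ≠ b) :
    uniformOn {a, b} = fairMix (PMF.pure a) (PMF.pure b) := by
  ext x
  rw [uniformOn_eq_uniformOfFinset (Finset.insert_nonempty a {b}), PMF.uniformOfFinset_apply,
    Finset.card_pair h, fairMix_apply]
  by_cases hxa : x = a
  · subst hxa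
    simp [PMF.pure_apply, h]
  · simp [PMF.pure_apply, hxa]

end UniformOn

namespace WLCGame

section History

variable {n : ℕ} (G : WLCGame n) (σ : G.Profile) (H : G.History) (i : Fin n)

open Classical in
theorem past_cons : G.past (σ :: H) i = insert (σ i) (G.past H i) := by
  ext c
  simp [mem_past, eq_comm]

theorem past_nil : G.past [] i = ∅ := by
  ext c
  simp [mem_past]

theorem past_singleton : G.past [σ] i = {σ i} := by
  classical
  rw [past_cons, past_nil, insert_empty_eq]

theorem nonFinal_cons : G.NonFinal (σ :: H) ↔ σ ∉ G.Win ∧ G.NonFinal H :=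
  List.forall_mem_cons

end History

variable (G : WLCGame 2)

theorem mem_coordinating_of_past_eq_singleton {H : G.History} {σ : G.Profile}
    (h : ∀ j, G.past H j = {σ j}) (i : Fin 2) (c : G.Choice i) :
    c ∈ G.coordinating H i ↔ Function.update σ i c ∈ G.Win := by
  simp only [mem_coordinating, h, Finset.mem_singleton]
  constructor
  · rintro ⟨τ, hτ, rfl, hσ⟩
    rwa [← Function.eq_update_iff.2 ⟨rfl, hσ⟩]
  · exact fun hc => ⟨_, hc, Function.update_self .., fun j hj => Function.update_of_ne hj ..⟩

/-- The profile `(a, b)` of a two-player game. -/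
def pair (a : G.Choice 0) (b : G.Choice 1) : G.Profile :=
  (piFinTwoEquiv G.Choice).symm (a, b)

theorem sum_profile (f : G.Profile → ℝ≥0∞) : ∑ σ, f σ = ∑ a, ∑ b, f (G.pair a b) := by
  rw [← Fintype.sum_prod_type', ← (piFinTwoEquiv G.Choice).symm.sum_comp]
  rfl

theorem update_zero (σ : G.Profile) (a : G.Choice 0) :
    Function.update σ 0 a = G.pair a (σ 1) := by
  ext i
  fin_cases i <;> rfl

theorem update_one (σ : G.Profile) (b : G.Choice 1) :
    Function.update σ 1 b = G.pair (σ 0) b := by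
  ext i
  fin_cases i <;> rfl

open Classical in
/-- The probability of winning a round in which the two players draw from `p` and `q`. -/
noncomputable def winProb (p : PMF (G.Choice 0)) (q : PMF (G.Choice 1)) : ℝ≥0∞ :=
  ∑ a, ∑ b, if G.pair a b ∈ G.Win then p a * q b else 0

section WinProb

variable {G}

theorem winProb_fairMix_left (p p' : PMF (G.Choice 0)) (q : PMF (G.Choice 1)) :
    G.winProb (fairMix p p') q = 2⁻¹ * G.winProb p q + 2⁻¹ * G.winProb p' q := by
  simp only [winProb, fairMix_apply, add_mul, mul_assoc, Finset.mul_sum, ← Finset.sum_add_distrib,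
    mul_ite, mul_zero, ite_add_ite, add_zero]

theorem winProb_fairMix_right (p : PMF (G.Choice 0)) (q q' : PMF (G.Choice 1)) :
    G.winProb p (fairMix q q') = 2⁻¹ * G.winProb p q + 2⁻¹ * G.winProb p q' := by
  simp only [winProb, fairMix_apply, mul_add, mul_left_comm _ (2⁻¹ : ℝ≥0∞), Finset.mul_sum,
    ← Finset.sum_add_distrib, mul_ite, mul_zero, ite_add_ite, add_zero]

theorem winProb_eq_one {p : PMF (G.Choice 0)} {q : PMF (G.Choice 1)}
    (h : ∀ a ∈ p.support, ∀ b ∈ q.support, G.pair a b ∈ G.Win) : G.winProb p q = 1 := by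
  classical
  have hterm : ∀ a b, (if G.pair a b ∈ G.Win then p a * q b else 0) = p a * q b := fun a b => by
    by_cases ha : p a = 0
    · rw [ha, zero_mul, ite_self]
    by_cases hb : q b = 0
    · rw [hb, mul_zero, ite_self]
    exact if_pos (h a ha b hb)
  simp only [winProb, hterm, ← Finset.mul_sum, sum_pmf_eq_one, mul_one]

end WinProb

end WLCGame

namespace Protocol

variable {π : Protocol 2} {G : WLCGame 2} {H : G.History}

theorem coordProb_zero_eq_winProb :
    π.coordProb G 0 H = G.winProb (π.dist G H 0) (π.dist G H 1) := by
  simp only [coordProb, roundProb, Fin.prod_univ_two, sum_profile]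
  rfl

/-- From the stage `(G, H)`, each player `i` repeats `σ i` with probability `1/2`, and otherwise
draws from `μ i` a choice that coordinates with the choice of the other player in `σ`. -/
structure MovesFrom (π : Protocol 2) (G : WLCGame 2) (H : G.History) (σ : G.Profile)
    (μ : ∀ i, PMF (G.Choice i)) : Prop where
  dist_eq : ∀ i, π.dist G H i = fairMix (PMF.pure (σ i)) (μ i)
  win : ∀ i, ∀ c ∈ (μ i).support, Function.update σ i c ∈ G.Win

namespace MovesFrom

variable {σ : G.Profile} {μ : ∀ i, PMF (G.Choice i)}

theorem half_le_coordProb (h : MovesFrom π G H σ μ) : 2⁻¹ ≤ π.coordProb G 0 H := by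
  have hmove₀ : G.winProb (μ 0) (PMF.pure (σ 1)) = 1 := winProb_eq_one fun a ha b hb => by
    rw [(PMF.mem_support_pure_iff ..).1 hb, ← update_zero]
    exact h.win 0 a ha
  have hmove₁ : G.winProb (PMF.pure (σ 0)) (μ 1) = 1 := winProb_eq_one fun a ha b hb => by
    rw [(PMF.mem_support_pure_iff ..).1 ha, ← update_one]
    exact h.win 1 b hb
  simp only [coordProb_zero_eq_winProb, h.dist_eq, winProb_fairMix_left, winProb_fairMix_right,
    hmove₀, hmove₁, mul_one]
  calc (2⁻¹ : ℝ≥0∞) = 2⁻¹ * 2⁻¹ + 2⁻¹ * 2⁻¹ := by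
        rw [← mul_add, ENNReal.inv_two_add_inv_two, mul_one]
    _ ≤ _ := by
        gcongr
        exacts [le_add_self, le_self_add]

theorem eq_or_mem_support (h : MovesFrom π G H σ μ) {τ : G.Profile}
    (hτ : π.roundProb G H τ ≠ 0) (i : Fin 2) : τ i = σ i ∨ τ i ∈ (μ i).support := by
  have hi : τ i ∈ (π.dist G H i).support := Finset.prod_ne_zero_iff.1 hτ i (Finset.mem_univ i)
  rwa [h.dist_eq, mem_support_fairMix, PMF.mem_support_pure_iff] at hi

theorem eq_or_forall_update_mem_win (h : MovesFrom π G H σ μ) {τ : G.Profile}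
    (hτ : π.roundProb G H τ ≠ 0) (hfail : τ ∉ G.Win) :
    τ = σ ∨ ∀ i, Function.update σ i (τ i) ∈ G.Win := by
  have hmove : ∀ i, τ i = σ i ∨ Function.update σ i (τ i) ∈ G.Win := fun i =>
    (h.eq_or_mem_support hτ i).imp_right (h.win i _)
  rcases hmove 0 with h₀ | h₀ <;> rcases hmove 1 with h₁ | h₁
  · exact .inl (funext (Fin.forall_fin_two.2 ⟨h₀, h₁⟩))
  · refine absurd ?_ hfail
    rwa [← Function.eq_update_iff.2 ⟨rfl, by simpa [Fin.forall_fin_two] using h₀⟩] at h₁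
  · refine absurd ?_ hfail
    rwa [← Function.eq_update_iff.2 ⟨rfl, by simpa [Fin.forall_fin_two] using h₁⟩] at h₀
  · exact .inr (Fin.forall_fin_two.2 ⟨h₀, h₁⟩)

end MovesFrom

end Protocol

section WaitOrMove

variable {G : WLCGame 2} {H : G.History} {σ τ : G.Profile}

theorem ne_of_update_mem_win {i : Fin 2} (hσ : σ ∉ G.Win)
    (h : Function.update σ i (τ i) ∈ G.Win) : σ i ≠ τ i := fun he =>
  hσ (by rwa [← he, Function.update_eq_self] at h)

theorem waitOrMove_movesFrom_of_past_singleton (hH : G.NonFinal H)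
    (hpast : ∀ i, G.past H i = {σ i}) :
    waitOrMove.MovesFrom G H σ fun i => uniformOn (G.coordinating H i) where
  dist_eq i := by
    change wmDist G H i = _
    rw [wmDist, if_pos ⟨hH, fun j => by rw [hpast, Finset.card_singleton]⟩, hpast,
      uniformOn_singleton]
    rfl
  win i c hc := by
    have hne := G.coordinating_nonempty H i fun j => by simp only [hpast, Finset.singleton_nonempty]
    rw [uniformOn_eq_uniformOfFinset hne, PMF.mem_support_uniformOfFinset_iff] at hc
    exact (G.mem_coordinating_of_past_eq_singleton hpast i c).1 hc

open Classical in
theorem waitOrMove_movesFrom_of_past_pair (hH : G.NonFinal H) (hσ : σ ∉ G.Win)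
    (hτ : ∀ i, Function.update σ i (τ i) ∈ G.Win) (hpast : ∀ i, G.past H i = {σ i, τ i}) :
    waitOrMove.MovesFrom G H σ fun i => PMF.pure (τ i) where
  dist_eq i := by
    have hcard : ∀ j, (G.past H j).card = 2 := fun j => by
      rw [hpast, Finset.card_pair (ne_of_update_mem_win hσ (hτ j))]
    change wmDist G H i = _
    rw [wmDist, if_neg fun h => by simpa [hcard] using h.2 0, if_pos ⟨hH, hcard⟩, hpast,
      uniformOn_pair (ne_of_update_mem_win hσ (hτ i))]
  win i c hc := by
    rw [(PMF.mem_support_pure_iff ..).1 hc]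
    exact hτ i

theorem waitOrMove_dist_nil (i : Fin 2) :
    waitOrMove.dist G [] i = PMF.uniformOfFintype (G.Choice i) := by
  change wmDist G [] i = _
  rw [wmDist, if_neg, if_neg] <;> simp [past_nil]

open Classical in
/-- The stages that the wait-or-move protocol reaches from a first round that fails: either both
players have only selected their choices in a losing profile `σ`, or they have both also selected
their choices in a second profile `τ`, each of which coordinates with the choice of the other
player in `σ`. -/
def WaitOrMoveStage (G : WLCGame 2) (H : G.History) : Prop :=
  G.NonFinal H ∧ ∃ σ ∉ G.Win, (∀ i, G.past H i = {σ i}) ∨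
    ∃ τ : G.Profile, (∀ i, Function.update σ i (τ i) ∈ G.Win) ∧
      ∀ i, G.past H i = {σ i, τ i}

namespace WaitOrMoveStage

theorem singleton (hσ : σ ∉ G.Win) : WaitOrMoveStage G [σ] :=
  ⟨List.forall_mem_singleton.2 hσ, σ, hσ, .inl (G.past_singleton σ)⟩

theorem exists_movesFrom (h : WaitOrMoveStage G H) : ∃ σ μ, waitOrMove.MovesFrom G H σ μ := by
  obtain ⟨hH, σ, hσ, hpast | ⟨τ, hτ, hpast⟩⟩ := h
  · exact ⟨_, _, waitOrMove_movesFrom_of_past_singleton hH hpast⟩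
  · exact ⟨_, _, waitOrMove_movesFrom_of_past_pair hH hσ hτ hpast⟩

theorem cons (h : WaitOrMoveStage G H) {ρ : G.Profile} (hρ : ρ ∉ G.Win)
    (hρ₀ : waitOrMove.roundProb G H ρ ≠ 0) : WaitOrMoveStage G (ρ :: H) := by
  classical
  obtain ⟨hH, σ, hσ, hpast | ⟨τ, hτ, hpast⟩⟩ := h
  · have hmoves := waitOrMove_movesFrom_of_past_singleton hH hpast
    refine ⟨(G.nonFinal_cons ..).2 ⟨hρ, hH⟩, σ, hσ, ?_⟩
    rcases hmoves.eq_or_forall_update_mem_win hρ₀ hρ with rfl | hwin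
    · exact .inl fun i => by rw [past_cons, hpast, Finset.pair_eq_singleton]
    · exact .inr ⟨ρ, hwin, fun i => by rw [past_cons, hpast, Finset.pair_comm]⟩
  · have hmoves := waitOrMove_movesFrom_of_past_pair hH hσ hτ hpast
    refine ⟨(G.nonFinal_cons ..).2 ⟨hρ, hH⟩, σ, hσ, .inr ⟨τ, hτ, fun i => ?_⟩⟩
    rw [past_cons, hpast, Finset.insert_eq_self, Finset.mem_insert, Finset.mem_singleton,
      ← PMF.mem_support_pure_iff (τ i)]
    exact hmoves.eq_or_mem_support hρ₀ i

theorem ectFrom_le_two (h : WaitOrMoveStage G H) : waitOrMove.ectFrom G H ≤ 2 := by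
  have hle := waitOrMove.ectFrom_le_inv_of_le_coordProb G (WaitOrMoveStage G)
    (fun H hH σ hσ hσ₀ => hH.cons hσ hσ₀)
    (fun H hH => by
      obtain ⟨σ, μ, hmoves⟩ := hH.exists_movesFrom
      exact hmoves.half_le_coordProb) h
  rwa [inv_inv] at hle

end WaitOrMoveStage

theorem waitOrMove_ect_le (G : WLCGame 2) :
    waitOrMove.ect G ≤ 1 + 2 * (1 - waitOrMove.coordProb G 0 []) := by
  rw [Protocol.ect, Protocol.ectFrom_eq_one_add_failExp, ← Protocol.failExp_const]
  gcongr
  exact Protocol.failExp_mono fun σ hσ _ => (WaitOrMoveStage.singleton hσ).ectFrom_le_two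

theorem waitOrMove_coordProb_zero_nil (G : WLCGame 2) :
    waitOrMove.coordProb G 0 [] =
      Nat.card G.Win / (Fintype.card (G.Choice 0) * Fintype.card (G.Choice 1)) := by
  classical
  simp only [Protocol.coordProb, Protocol.roundProb, Fin.prod_univ_two, waitOrMove_dist_nil,
    PMF.uniformOfFintype_apply]
  rw [← Finset.sum_filter, Finset.sum_const, nsmul_eq_mul, Nat.card_eq_fintype_card,
    Fintype.card_subtype, div_eq_mul_inv, ENNReal.mul_inv (by simp) (by simp)]

end WaitOrMove

namespace WLCGame

section CardWin

variable {n : ℕ} (G : WLCGame n)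

theorem surjective_apply_win (i : Fin n) : Function.Surjective fun σ : G.Win => σ.1 i := fun c =>
  let ⟨σ, hσ, h⟩ := G.no_surely_losing i c
  ⟨⟨σ, hσ⟩, h⟩

theorem card_choice_le_card_win (i : Fin n) : Fintype.card (G.Choice i) ≤ Nat.card G.Win := by
  rw [← Nat.card_eq_fintype_card]
  exact Nat.card_le_card_of_surjective _ (G.surjective_apply_win i)

variable {G} {m : ℕ} [NeZero m]

theorem isomorphic_choiceMatching_of_card_eq (hc : ∀ i, Fintype.card (G.Choice i) = m)
    (hW : Nat.card G.Win = m) : G.Isomorphic (choiceMatching n m) := by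
  classical
  have hbij : ∀ i, Function.Bijective fun σ : G.Win => σ.1 i := fun i => by
    rw [Fintype.bijective_iff_surjective_and_card, ← Nat.card_eq_fintype_card, hW, hc]
    exact ⟨G.surjective_apply_win i, rfl⟩
  let number : G.Win ≃ Fin m := Finite.equivFinOfCardEq hW
  let winning : ∀ i, G.Choice i ≃ G.Win := fun i => (Equiv.ofBijective _ (hbij i)).symm
  have hwinning : ∀ i c (τ : G.Win), winning i c = τ ↔ c = τ.1 i := fun i c τ =>
    Equiv.symm_apply_eq _
  refine ⟨⟨1, fun i => (winning i).trans number, fun σ => ?_, rfl⟩⟩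
  calc σ ∈ G.Win ↔ ∃ τ : G.Win, ∀ i, σ i = τ.1 i := by
        simp only [← funext_iff, Subtype.exists, exists_prop, exists_eq_right']
    _ ↔ ∃ k, ∀ i, number (winning i (σ i)) = k := by
        rw [number.symm.surjective.exists.trans]
        simp only [← hwinning, Equiv.eq_symm_apply]

end CardWin

variable {G : WLCGame 2} {m : ℕ} [NeZero m]

theorem IsChoiceGame.card_mul_card_lt (hG : G.IsChoiceGame m)
    (hne : ¬ G.Isomorphic (choiceMatching 2 m)) :
    Fintype.card (G.Choice 0) * Fintype.card (G.Choice 1) < m * Nat.card G.Win := by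
  have hwin : m ≤ Nat.card G.Win := by
    rw [hG]
    exact max_le (G.card_choice_le_card_win 0) (G.card_choice_le_card_win 1)
  have h₀ : Fintype.card (G.Choice 0) ≤ m := hG ▸ le_max_left ..
  have h₁ : Fintype.card (G.Choice 1) ≤ m := hG ▸ le_max_right ..
  refine lt_of_le_of_ne (Nat.mul_le_mul h₀ (h₁.trans hwin)) fun heq => hne ?_
  obtain ⟨hc₀, hc₁⟩ := (mul_eq_mul_iff_eq_and_eq_of_pos h₀ (h₁.trans hwin) Fintype.card_pos
    ((NeZero.pos m).trans_le hwin)).1 heq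
  have hW : Nat.card G.Win = m := (hc₁.symm.trans_le h₁).antisymm hwin
  exact isomorphic_choiceMatching_of_card_eq (Fin.forall_fin_two.2 ⟨hc₀, hc₁.trans hW⟩) hW

theorem IsChoiceGame.inv_lt_coordProb (hG : G.IsChoiceGame m)
    (hne : ¬ G.Isomorphic (choiceMatching 2 m)) :
    (m : ℝ≥0∞)⁻¹ < waitOrMove.coordProb G 0 [] := by
  rw [waitOrMove_coordProb_zero_nil, ENNReal.lt_div_iff_mul_lt (by simp) (by simp), mul_comm,
    ← div_eq_mul_inv, ENNReal.div_lt_iff (by simp [NeZero.ne m]) (by simp),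
    mul_comm (Nat.card _ : ℝ≥0∞)]
  exact_mod_cast hG.card_mul_card_lt hne

end WLCGame

theorem sum_mul_apply_perm_le_sum_mul_self {ι : Type*} [Fintype ι] (p : ι → ℝ≥0∞)
    (τ : Equiv.Perm ι) : ∑ i, p i * p (τ i) ≤ ∑ i, p i * p i := by
  by_cases hp : ∀ i, p i ≠ ⊤
  · lift p to ι → NNReal using hp
    simpa only [← ENNReal.coe_mul, ← ENNReal.ofNNReal_finsetSum, ENNReal.coe_le_coe] using
      (monovary_self p).sum_mul_comp_perm_le_sum_mul (σ := τ)
  · obtain ⟨i, hi⟩ := not_forall_not.1 hp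
    refine le_top.trans_eq (ENNReal.sum_eq_top.2 ⟨i, Finset.mem_univ i, ?_⟩).symm
    rw [hi, ENNReal.top_mul_top]

namespace ChoiceMatching

section Players

variable {n m : ℕ} [NeZero m]

/-- The edge of the matching to which the choice of player `i` in `σ` belongs. -/
def edge (σ : (choiceMatching n m).Profile) (i : Fin n) : Fin m := σ i

open Classical in
/-- The edges that no player has touched so far. -/
noncomputable def untouched (H : (choiceMatching n m).History) : Finset (Fin m) :=
  {c | ∀ σ ∈ H, ∀ i, edge σ i ≠ c}

theorem mem_untouched {H : (choiceMatching n m).History} {c : Fin m} :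
    c ∈ untouched H ↔ ∀ σ ∈ H, ∀ i, edge σ i ≠ c := by
  simp [untouched]

theorem untouched_nil : untouched ([] : (choiceMatching n m).History) = Finset.univ := by
  simp [untouched]

/-- The probability that player `i` touches the edge `c` in the next round. -/
noncomputable def prob (π : Protocol n) (H : (choiceMatching n m).History) (i : Fin n)
    (c : Fin m) : ℝ≥0∞ :=
  π.dist (choiceMatching n m) H i c

variable (π : Protocol n) {H : (choiceMatching n m).History}

theorem sum_prob (H : (choiceMatching n m).History) (i : Fin n) : ∑ c, prob π H i c = 1 :=
  sum_pmf_eq_one (π.dist (choiceMatching n m) H i)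

theorem prob_perm (ρ : Equiv.Perm (Fin n)) (e : Equiv.Perm (Fin m))
    (h : ∀ σ ∈ H, ∀ i, e (edge σ (ρ i)) = edge σ i) (i : Fin n) (c : Fin m) :
    prob π H (ρ i) c = prob π H i (e c) := by
  refine π.structural _ H _ H ⟨ρ, fun _ => e, fun σ => ⟨?_, ?_⟩, ?_⟩ i c
  · rintro ⟨k, hk⟩
    exact ⟨e k, fun j => congrArg e (hk (ρ j))⟩
  · rintro ⟨k, hk⟩
    refine ⟨e.symm k, ρ.surjective.forall.2 fun j => e.eq_symm_apply.2 (hk j)⟩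
  · exact ((List.map_congr_left fun σ hσ => funext (h σ hσ)).trans (List.map_id H)).symm

theorem prob_eq_of_mem_untouched {a b : Fin m} (ha : a ∈ untouched H) (hb : b ∈ untouched H)
    (i : Fin n) : prob π H i a = prob π H i b := by
  have hswap := prob_perm π 1 (Equiv.swap a b) (fun σ hσ j => Equiv.swap_apply_of_ne_of_ne
    (mem_untouched.1 ha σ hσ j) (mem_untouched.1 hb σ hσ j)) i a
  rwa [Equiv.swap_apply_left] at hswap

theorem prob_nil (i : Fin n) (c : Fin m) :
    prob π ([] : (choiceMatching n m).History) i c = (m : ℝ≥0∞)⁻¹ := by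
  refine ENNReal.eq_inv_of_mul_eq_one_left ?_
  calc prob π [] i c * m = ∑ _a : Fin m, prob π ([] : (choiceMatching n m).History) i c := by
        rw [Finset.sum_const, Finset.card_univ, Fintype.card_fin, nsmul_eq_mul, mul_comm]
    _ = ∑ a, prob π [] i a := Finset.sum_congr rfl fun a _ =>
        prob_eq_of_mem_untouched π (by simp [untouched_nil]) (by simp [untouched_nil]) i
    _ = 1 := sum_prob π [] i

end Players

variable {m : ℕ} [NeZero m]

/-- The profile in which the two players touch the edges `a` and `b`. -/
def ofEdges (a b : Fin m) : (choiceMatching 2 m).Profile :=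
  (choiceMatching 2 m).pair a b

theorem ofEdges_mem_win {a b : Fin m} :
    ofEdges a b ∈ (choiceMatching 2 m).Win ↔ a = b := by
  constructor
  · rintro ⟨k, hk⟩
    exact (hk 0).trans (hk 1).symm
  · rintro rfl
    exact ⟨a, Fin.forall_fin_two.2 ⟨rfl, rfl⟩⟩

theorem exists_ofEdges_eq (σ : (choiceMatching 2 m).Profile) : ∃ a b, ofEdges a b = σ :=
  ⟨σ 0, σ 1, funext (Fin.forall_fin_two.2 ⟨rfl, rfl⟩)⟩

theorem untouched_cons_ofEdges (H : (choiceMatching 2 m).History) (a b : Fin m) :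
    untouched (ofEdges a b :: H) = untouched H \ {a, b} := by
  ext c
  have hpair : (∀ i, edge (ofEdges a b) i ≠ c) ↔ c ∉ ({a, b} : Finset (Fin m)) := by
    simp only [Finset.mem_insert, Finset.mem_singleton, not_or, ne_comm (a := c)]
    exact Fin.forall_fin_two
  rw [Finset.mem_sdiff, mem_untouched, mem_untouched, List.forall_mem_cons, hpair, and_comm]

theorem sum_profile_eq_sum_ofEdges (f : (choiceMatching 2 m).Profile → ℝ≥0∞) :
    ∑ σ, f σ = ∑ a : Fin m, ∑ b : Fin m, f (ofEdges a b) :=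
  sum_profile _ f

section Probability

variable (π : Protocol 2) (H : (choiceMatching 2 m).History)

theorem roundProb_ofEdges (a b : Fin m) :
    π.roundProb (choiceMatching 2 m) H (ofEdges a b) = prob π H 0 a * prob π H 1 b :=
  Fin.prod_univ_two _

theorem coordProb_zero :
    π.coordProb (choiceMatching 2 m) 0 H = ∑ a, prob π H 0 a * prob π H 1 a := by
  simp only [Protocol.coordProb, sum_profile_eq_sum_ofEdges, ofEdges_mem_win, roundProb_ofEdges,
    Finset.sum_ite_eq, Finset.mem_univ, if_true]

theorem failExp_eq (f : (choiceMatching 2 m).Profile → ℝ≥0∞) :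
    π.failExp (choiceMatching 2 m) H f =
      ∑ a, ∑ b with b ≠ a, prob π H 0 a * prob π H 1 b * f (ofEdges a b) := by
  simp only [Protocol.failExp, Finset.sum_filter, sum_profile_eq_sum_ofEdges, ofEdges_mem_win,
    roundProb_ofEdges, ne_comm (b := (_ : Fin m)), ← ne_eq]

theorem coordProb_zero_nil :
    π.coordProb (choiceMatching 2 m) 0 [] = (m : ℝ≥0∞)⁻¹ := by
  simp only [coordProb_zero, prob_nil π 0, ← Finset.mul_sum, sum_prob, mul_one]

end Probability

/-- `τ` is an involution of the edges that interchanges the edges touched by the two players in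
every round, and whose fixed points are the untouched edges. -/
structure IsSymmetry (H : (choiceMatching 2 m).History) (τ : Equiv.Perm (Fin m)) : Prop where
  involutive : Function.Involutive τ
  fixed_iff : ∀ c, τ c = c ↔ c ∈ untouched H
  map_edge : ∀ σ ∈ H, τ (edge σ 0) = edge σ 1

theorem isSymmetry_nil : IsSymmetry ([] : (choiceMatching 2 m).History) 1 :=
  ⟨fun _ => rfl, by simp [untouched_nil], by simp⟩

namespace IsSymmetry

variable {H : (choiceMatching 2 m).History} {τ : Equiv.Perm (Fin m)} (h : IsSymmetry H τ)
include h

theorem apply_mem_untouched {c : Fin m} : τ c ∈ untouched H ↔ c ∈ untouched H := by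
  rw [← h.fixed_iff, ← h.fixed_iff, EmbeddingLike.apply_eq_iff_eq]

theorem untouched_cons_touched {a : Fin m} (ha : a ∉ untouched H) :
    untouched (ofEdges a (τ a) :: H) = untouched H := by
  rw [untouched_cons_ofEdges, Finset.sdiff_eq_self_iff_disjoint, Finset.disjoint_insert_right,
    Finset.disjoint_singleton_right, h.apply_mem_untouched]
  exact ⟨ha, ha⟩

theorem cons_touched {a : Fin m} (ha : a ∉ untouched H) : IsSymmetry (ofEdges a (τ a) :: H) τ where
  involutive := h.involutive
  fixed_iff c := by rw [h.untouched_cons_touched ha, h.fixed_iff]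
  map_edge := List.forall_mem_cons.2 ⟨rfl, h.map_edge⟩

theorem cons_untouched {a b : Fin m} (ha : a ∈ untouched H) (hb : b ∈ untouched H)
    (hab : a ≠ b) : IsSymmetry (ofEdges a b :: H) (τ * Equiv.swap a b) := by
  have hτa : τ a = a := (h.fixed_iff a).2 ha
  have hτb : τ b = b := (h.fixed_iff b).2 hb
  have hcomm : ∀ c, Equiv.swap a b (τ c) = τ (Equiv.swap a b c) := fun c => by
    have hmul := Equiv.mul_swap_eq_swap_mul τ a b
    rw [hτa, hτb] at hmul
    exact (DFunLike.congr_fun hmul c).symm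
  refine ⟨fun c => ?_, fun c => ?_, List.forall_mem_cons.2 ⟨?_, fun σ hσ => ?_⟩⟩
  · simp only [Equiv.Perm.mul_apply, hcomm, h.involutive _, Equiv.swap_apply_self]
  · rw [untouched_cons_ofEdges, Finset.mem_sdiff, Finset.mem_insert, Finset.mem_singleton,
      Equiv.Perm.mul_apply]
    rcases eq_or_ne c a with rfl | hca
    · simp [hτb, hab.symm]
    rcases eq_or_ne c b with rfl | hcb
    · simp [hτa, hab]
    simp [Equiv.swap_apply_of_ne_of_ne hca hcb, h.fixed_iff, hca, hcb]
  · exact (congrArg τ (Equiv.swap_apply_left a b)).trans hτb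
  · rw [Equiv.Perm.mul_apply, Equiv.swap_apply_of_ne_of_ne (mem_untouched.1 ha σ hσ 0)
      (mem_untouched.1 hb σ hσ 0), h.map_edge σ hσ]

variable (π : Protocol 2)

theorem prob_apply (c : Fin m) : prob π H 1 (τ c) = prob π H 0 c := by
  refine (prob_perm π (Equiv.swap 0 1) τ (fun σ hσ => Fin.forall_fin_two.2 ⟨?_, ?_⟩) 1 c).symm
  · rw [Equiv.swap_apply_left, ← h.map_edge σ hσ, h.involutive]
  · rw [Equiv.swap_apply_right, h.map_edge σ hσ]

theorem coordProb_zero_le :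
    π.coordProb (choiceMatching 2 m) 0 H ≤ ∑ a, prob π H 0 a * prob π H 0 a := by
  have hmirror : ∀ a, prob π H 1 a = prob π H 0 (τ a) := fun a => by
    rw [← h.prob_apply π, h.involutive]
  simp only [coordProb_zero, hmirror]
  exact sum_mul_apply_perm_le_sum_mul_self (prob π H 0) τ

theorem prob_mul_self_le_of_notMem_untouched {a : Fin m} (ha : a ∉ untouched H)
    {f : Fin m → ℝ≥0∞} (hf : 1 ≤ f (τ a)) :
    prob π H 0 a * prob π H 0 a ≤ ∑ b with b ≠ a, prob π H 0 a * prob π H 1 b * f b := by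
  calc prob π H 0 a * prob π H 0 a
      ≤ prob π H 0 a * prob π H 1 (τ a) * f (τ a) := by
        rw [h.prob_apply]
        exact le_mul_of_one_le_right zero_le hf
    _ ≤ ∑ b with b ≠ a, prob π H 0 a * prob π H 1 b * f b :=
        Finset.single_le_sum (f := fun b => prob π H 0 a * prob π H 1 b * f b)
          (fun _ _ => zero_le) (by simpa [h.fixed_iff] using ha)

theorem prob_mul_self_le_of_mem_untouched {a : Fin m} (ha : a ∈ untouched H) {x : ℝ≥0∞}
    (hx : 1 ≤ ((untouched H).card - 1 : ℕ) * x) {f : Fin m → ℝ≥0∞}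
    (hf : ∀ b ∈ untouched H, a ≠ b → x ≤ f b) :
    prob π H 0 a * prob π H 0 a ≤ ∑ b with b ≠ a, prob π H 0 a * prob π H 1 b * f b := by
  have hprob : ∀ b ∈ untouched H, prob π H 1 b = prob π H 0 a := fun b hb => by
    rw [prob_eq_of_mem_untouched π hb ha, ← h.prob_apply π, (h.fixed_iff a).2 ha]
  calc prob π H 0 a * prob π H 0 a
      ≤ prob π H 0 a * prob π H 0 a * (((untouched H).card - 1 : ℕ) * x) :=
        le_mul_of_one_le_right zero_le hx
    _ = ∑ _b ∈ (untouched H).erase a, prob π H 0 a * prob π H 0 a * x := by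
        rw [Finset.sum_const, Finset.card_erase_of_mem ha, nsmul_eq_mul, mul_left_comm]
    _ ≤ ∑ b ∈ (untouched H).erase a, prob π H 0 a * prob π H 1 b * f b := by
        refine Finset.sum_le_sum fun b hb => ?_
        obtain ⟨hba, hb⟩ := Finset.mem_erase.1 hb
        rw [hprob b hb]
        gcongr
        exact hf b hb hba.symm
    _ ≤ ∑ b with b ≠ a, prob π H 0 a * prob π H 1 b * f b :=
        Finset.sum_le_sum_of_subset fun b hb => by simpa using (Finset.mem_erase.1 hb).1

theorem coordProb_zero_le_failExp {f : (choiceMatching 2 m).Profile → ℝ≥0∞} {x : ℝ≥0∞}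
    (hx : (untouched H).card ≠ 0 → 1 ≤ ((untouched H).card - 1 : ℕ) * x)
    (htouched : ∀ a ∉ untouched H, 1 ≤ f (ofEdges a (τ a)))
    (huntouched : ∀ a ∈ untouched H, ∀ b ∈ untouched H, a ≠ b → x ≤ f (ofEdges a b)) :
    π.coordProb (choiceMatching 2 m) 0 H ≤ π.failExp (choiceMatching 2 m) H f := by
  refine (h.coordProb_zero_le π).trans ?_
  rw [failExp_eq]
  refine Finset.sum_le_sum fun a _ => ?_
  by_cases ha : a ∈ untouched H
  · exact h.prob_mul_self_le_of_mem_untouched π ha (hx (Finset.card_ne_zero_of_mem ha))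
      (huntouched a ha)
  · exact h.prob_mul_self_le_of_notMem_untouched π ha (htouched a ha)

end IsSymmetry

/-- A lower bound for the expected number of rounds after the next one in a symmetric stage with
`u` untouched edges. The value at `1` is `0` because both players may pick the single untouched
edge, and the value at `3` is `1/2` because two players who pick different untouched edges leave a
single one untouched. -/
noncomputable def excess (u : ℕ) : ℝ≥0∞ :=
  if u = 1 then 0 else if u = 3 then 2⁻¹ else 1

theorem excess_le_one (u : ℕ) : excess u ≤ 1 := by
  unfold excess
  split_ifs <;> simp

theorem excess_of_ne {u : ℕ} (h1 : u ≠ 1) (h3 : u ≠ 3) : excess u = 1 := by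
  rw [excess, if_neg h1, if_neg h3]

theorem one_le_mul_excess {u : ℕ} (h0 : u ≠ 0) (h1 : u ≠ 1) (h3 : u ≠ 3) :
    1 ≤ ((u - 1 : ℕ) : ℝ≥0∞) * excess (u - 2) := by
  rcases eq_or_ne u 5 with rfl | h5
  · calc (1 : ℝ≥0∞) = 2 * 2⁻¹ := (ENNReal.mul_inv_cancel two_ne_zero ENNReal.ofNat_ne_top).symm
      _ ≤ ((5 - 1 : ℕ) : ℝ≥0∞) * excess (5 - 2) := by
        simp only [excess]
        gcongr <;> norm_num
  · rw [excess_of_ne (by lia) (by lia), mul_one]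
    exact_mod_cast (by lia : 1 ≤ u - 1)

open Classical in
/-- The excess of a stage that has a symmetry, and `0` for the other stages. -/
noncomputable def stageExcess (H : (choiceMatching 2 m).History) : ℝ≥0∞ :=
  if ∃ τ, IsSymmetry H τ then excess (untouched H).card else 0

theorem stageExcess_le_one (H : (choiceMatching 2 m).History) : stageExcess H ≤ 1 := by
  unfold stageExcess
  split_ifs
  exacts [excess_le_one _, zero_le]

section StageExcess

variable {H : (choiceMatching 2 m).History} {τ : Equiv.Perm (Fin m)}

theorem IsSymmetry.stageExcess_eq (h : IsSymmetry H τ) :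
    stageExcess H = excess (untouched H).card :=
  if_pos ⟨τ, h⟩

theorem IsSymmetry.stageExcess_cons_touched (h : IsSymmetry H τ) {a : Fin m}
    (ha : a ∉ untouched H) : stageExcess (ofEdges a (τ a) :: H) = stageExcess H := by
  rw [(h.cons_touched ha).stageExcess_eq, h.untouched_cons_touched ha, h.stageExcess_eq]

theorem IsSymmetry.stageExcess_cons_untouched (h : IsSymmetry H τ) {a b : Fin m}
    (ha : a ∈ untouched H) (hb : b ∈ untouched H) (hab : a ≠ b) :
    stageExcess (ofEdges a b :: H) = excess ((untouched H).card - 2) := by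
  rw [(h.cons_untouched ha hb hab).stageExcess_eq, untouched_cons_ofEdges,
    Finset.card_sdiff_of_subset (Finset.insert_subset ha (Finset.singleton_subset_iff.2 hb)),
    Finset.card_pair hab]

theorem stageExcess_singleton {a b : Fin m} (hab : a ≠ b) :
    stageExcess [ofEdges a b] = excess (m - 2) := by
  rw [isSymmetry_nil.stageExcess_cons_untouched _ _ hab] <;> simp [untouched_nil]

variable (π : Protocol 2)

theorem IsSymmetry.half_le_failExp_one (h : IsSymmetry H τ) (h1 : (untouched H).card ≠ 1) :
    2⁻¹ ≤ π.failExp (choiceMatching 2 m) H fun _ => 1 := by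
  have hwin : π.coordProb (choiceMatching 2 m) 0 H ≤ π.failExp (choiceMatching 2 m) H fun _ => 1 :=
    h.coordProb_zero_le_failExp π (x := 1)
      (fun h0 => by rw [mul_one]; exact_mod_cast (by lia : 1 ≤ (untouched H).card - 1))
      (fun _ _ => le_rfl) (fun _ _ _ _ _ => le_rfl)
  rw [ENNReal.inv_le_iff_le_mul (by simp) (by simp)]
  calc 1 = π.coordProb (choiceMatching 2 m) 0 H + π.failExp (choiceMatching 2 m) H fun _ => 1 :=
        (π.coordProb_zero_add_failExp_one _ H).symm
    _ ≤ π.failExp (choiceMatching 2 m) H (fun _ => 1) +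
          π.failExp (choiceMatching 2 m) H fun _ => 1 := by gcongr
    _ = 2 * π.failExp (choiceMatching 2 m) H fun _ => 1 := (two_mul _).symm

theorem IsSymmetry.one_le_failExp (h : IsSymmetry H τ) (h1 : (untouched H).card ≠ 1)
    (h3 : (untouched H).card ≠ 3) :
    1 ≤ π.failExp (choiceMatching 2 m) H fun σ => 1 + stageExcess (σ :: H) := by
  have hexcess : stageExcess H = 1 := by rw [h.stageExcess_eq, excess_of_ne h1 h3]
  calc 1 = π.failExp (choiceMatching 2 m) H (fun _ => 1) +
          π.coordProb (choiceMatching 2 m) 0 H := by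
        rw [add_comm, Protocol.coordProb_zero_add_failExp_one]
    _ ≤ π.failExp (choiceMatching 2 m) H (fun _ => 1) +
          π.failExp (choiceMatching 2 m) H fun σ => stageExcess (σ :: H) := by
        gcongr
        exact h.coordProb_zero_le_failExp π (fun h0 => one_le_mul_excess h0 h1 h3)
          (fun a ha => by rw [h.stageExcess_cons_touched ha, hexcess])
          (fun a ha b hb hab => (h.stageExcess_cons_untouched ha hb hab).ge)
    _ = π.failExp (choiceMatching 2 m) H fun σ => 1 + stageExcess (σ :: H) :=
        Protocol.failExp_add.symm

theorem stageExcess_le_failExp (H : (choiceMatching 2 m).History) :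
    stageExcess H ≤ π.failExp (choiceMatching 2 m) H fun σ => 1 + stageExcess (σ :: H) := by
  by_cases hsymm : ∃ τ, IsSymmetry H τ
  swap
  · rw [stageExcess, if_neg hsymm]
    exact zero_le
  obtain ⟨τ, h⟩ := hsymm
  by_cases h1 : (untouched H).card = 1
  · rw [h.stageExcess_eq, excess, if_pos h1]
    exact zero_le
  by_cases h3 : (untouched H).card = 3
  · rw [h.stageExcess_eq, excess, if_neg h1, if_pos h3]
    exact (h.half_le_failExp_one π h1).trans (Protocol.failExp_mono fun _ _ _ => le_self_add)
  · exact (stageExcess_le_one H).trans (h.one_le_failExp π h1 h3)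

theorem one_add_stageExcess_le_ectFrom (H : (choiceMatching 2 m).History) :
    1 + stageExcess H ≤ π.ectFrom (choiceMatching 2 m) H := by
  refine π.le_ectFrom_of_le_one_add_failExp _ (fun H => 1 + stageExcess H) (B := 1 + 1)
    (by simp) (fun H => ?_) (fun H => ?_) H
  · gcongr
    exact stageExcess_le_one H
  · gcongr
    exact stageExcess_le_failExp π H

theorem le_ect (h3 : m ≠ 3) (h5 : m ≠ 5) :
    1 + 2 * (1 - (m : ℝ≥0∞)⁻¹) ≤ π.ect (choiceMatching 2 m) := by
  rw [← coordProb_zero_nil π, ← Protocol.failExp_const, Protocol.ect,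
    Protocol.ectFrom_eq_one_add_failExp]
  gcongr
  refine Protocol.failExp_mono fun σ hσ _ => ?_
  obtain ⟨a, b, rfl⟩ := exists_ofEdges_eq σ
  have hle := one_add_stageExcess_le_ectFrom π [ofEdges a b]
  rwa [stageExcess_singleton fun hab => hσ (ofEdges_mem_win.2 hab),
    excess_of_ne (by lia) (by lia), one_add_one_eq_two] at hle

theorem isOptimalECT (h3 : m ≠ 3) (h5 : m ≠ 5) :
    IsOptimalECT (choiceMatching 2 m) (1 + 2 * (1 - (m : ℝ≥0∞)⁻¹)) := by
  refine ⟨⟨waitOrMove, ?_⟩, ?_⟩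
  · refine le_antisymm ?_ (le_ect waitOrMove h3 h5)
    rw [← coordProb_zero_nil waitOrMove]
    exact waitOrMove_ect_le _
  · rintro _ ⟨π, rfl⟩
    exact le_ect π h3 h5

end StageExcess

end ChoiceMatching

theorem mainTheorem7 (m : ℕ) [NeZero m] (h1 : m ≠ 1) (h3 : m ≠ 3) (h5 : m ≠ 5)
    (G : WLCGame 2) (hG : G.IsChoiceGame m)
    (hne : ¬ G.Isomorphic (WLCGame.choiceMatching 2 m)) :
    ∃ r : ENNReal, IsOptimalECT (WLCGame.choiceMatching 2 m) r ∧ waitOrMove.ect G < r := by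
  refine ⟨_, ChoiceMatching.isOptimalECT h3 h5, (waitOrMove_ect_le G).trans_lt ?_⟩
  have hfail : 1 - waitOrMove.coordProb G 0 [] < 1 - (m : ℝ≥0∞)⁻¹ := by
    refine ENNReal.sub_lt_of_sub_lt (waitOrMove.coordProb_zero_le_one G [])
      (.inl ENNReal.one_ne_top) ?_
    rw [ENNReal.sub_sub_cancel ENNReal.one_ne_top
      (ENNReal.inv_le_one.2 (by exact_mod_cast NeZero.one_le))]
    exact hG.inv_lt_coordProb hne
  gcongr
  · exact ENNReal.one_ne_top
  · exact ENNReal.ofNat_ne_top
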